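/- A set $\Omega\subset\mathbb{R}$ that is Lebesgue measurable with $0<|\Omega|<\infty$ is called spectral if there is $\Lambda\subset\mathbb{R}$ (a spectrum of $\Omega$) such that the functions $e_\lambda(x)=|\Omega|^{-1/2}e^{2\pi i\lambda x}\chi_\Omega(x)$, $\lambda\in\Lambda$, form an orthonormal basis of $L^2(\Omega)$. A measurable set $T\subset\mathbb{R}$ with $0<|T|<\infty$ tiles $\mathbb{R}$ by $\mathcal{T}\subset\mathbb{R}$ if the translates $T+t$, $t\in\mathcal{T}$, form a partition of $\mathbb{R}$ up to null sets, and it tiles $\mathbb{R}$ if it does so by some $\mathcal{T}$. **Theorem.** Let $\Omega=[0,r]\cup[a,a+1-r]$ with $0<r<1$ and $r<a$. If $\Omega$ is spectral, then $\Omega$ tiles $\mathbb{R}$ by translations. Moreover, let $\Lambda$ be any spectrum of $\Omega$, and put $$\varphi_\Omega(x)=\bigl((e^{2\pi i x r},\,e^{2\pi i x(a+1-r)}),\,(1,\,e^{2\pi i x a})\bigr)\in\mathbb{C}^2\times\mathbb{C}^2 .$$ Then: 1. for all $\lambda,\mu\in\Lambda$ one has $\varphi_\Omega(\lambda)\odot\varphi_\Omega(\mu)=0$,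 where $(v_1,v_2)\odot(w_1,w_2)=\langle v_1,w_1\rangle-\langle v_2,w_2\rangle$ for the usual inner product on $\mathbb{C}^2$; 2. the linear span $V_\Omega(\Lambda)$ of $\varphi_\Omega(\Lambda)$ over $\mathbb{C}$ has dimension $2$; 3. if $0\in\Lambda$, then either $\Lambda=\mathbb{Z}$ and $\Omega$ tiles $\mathbb{R}$ by $\mathbb{Z}$, or $r=\tfrac12$ and $a\in\tfrac12\mathbb{Z}$. -/

import Mathlib

open MeasureTheory

noncomputable section

namespace Fuglede

/-- The normalized exponential `e_λ(x) = |Ω|^{-1/2} e^{2 π i λ x} χ_Ω(x)`. -/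
def normExp (Ω : Set ℝ) (l : ℝ) : ℝ → ℂ :=
  Ω.indicator fun x =>
    (((volume.real Ω) ^ (-(1 / 2) : ℝ) : ℝ) : ℂ) *
      Complex.exp (2 * (Real.pi : ℂ) * Complex.I * (l : ℂ) * (x : ℂ))

/-- `(Ω, Λ)` is a spectral pair: `Ω` is a Lebesgue measurable subset of `ℝ` of finite positive
measure, and the exponentials `e_λ`, `λ ∈ Λ`, form an orthonormal (Hilbert) basis of `L²(Ω)`. -/
structure IsSpectralPair (Ω Λ : Set ℝ) : Prop where
  nullMeasurableSet : NullMeasurableSet Ω volume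
  measure_pos : 0 < volume Ω
  measure_lt_top : volume Ω < ⊤
  exists_basis : ∃ b : HilbertBasis Λ ℂ (Lp ℂ 2 (volume.restrict Ω)),
    ∀ l : Λ, (b l : ℝ → ℂ) =ᵐ[volume.restrict Ω] normExp Ω l

/-- `Ω` is a spectral set: it admits a spectrum. -/
def IsSpectralSet (Ω : Set ℝ) : Prop :=
  ∃ Λ : Set ℝ, IsSpectralPair Ω Λ

/-- `T + t = {x + t : x ∈ T}`. -/
def translate (T : Set ℝ) (t : ℝ) : Set ℝ :=
  (fun x => x + t) '' T

/-- `(T, S)` is a tiling pair: `T` is a Lebesgue measurable subset of `ℝ` of finite positive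
measure, and the translates `T + t`, `t ∈ S`, form a partition of `ℝ` up to null sets. -/
structure IsTilingPair (T S : Set ℝ) : Prop where
  nullMeasurableSet : NullMeasurableSet T volume
  measure_pos : 0 < volume T
  measure_lt_top : volume T < ⊤
  aedisjoint : ∀ s ∈ S, ∀ t ∈ S, s ≠ t → AEDisjoint volume (translate T s) (translate T t)
  ae_covers : ∀ᵐ x : ℝ ∂volume, ∃ t ∈ S, x ∈ translate T t

/-- `T` tiles `ℝ` by translations. -/
def TilesByTranslation (T : Set ℝ) : Prop :=
  ∃ S : Set ℝ, IsTilingPair T S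

/-- The set `[0, r] ∪ [a, a + 1 - r]`. -/
def twoIntervals (r a : ℝ) : Set ℝ :=
  Set.Icc 0 r ∪ Set.Icc a (a + 1 - r)

/-- The set `ℤ`, as a subset of `ℝ`. -/
def integers : Set ℝ :=
  Set.range fun n : ℤ => (n : ℝ)

/-- The form `v ⊙ w = ⟨v₁, w₁⟩ - ⟨v₂, w₂⟩` on `ℂ² × ℂ²`, where `⟨·,·⟩` is the usual inner product
(linear in the first variable, conjugate linear in the second). -/
def nullForm (v w : (Fin 2 → ℂ) × (Fin 2 → ℂ)) : ℂ :=
  v.1 ⬝ᵥ star w.1 - v.2 ⬝ᵥ star w.2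

/-- `S` is a set of mutually null vectors. -/
def IsMutuallyNull (S : Set ((Fin 2 → ℂ) × (Fin 2 → ℂ))) : Prop :=
  ∀ v ∈ S, ∀ w ∈ S, nullForm v w = 0

/-- `e(t) = e^{2 π i t}`. -/
def unitExp (t : ℝ) : ℂ :=
  Complex.exp (2 * (Real.pi : ℂ) * Complex.I * (t : ℂ))

/-- The map `φ_Ω` for `Ω = [0, r] ∪ [a, a + 1 - r]`: the first component collects the right
endpoints, the second one the left endpoints. -/
def embed (r a x : ℝ) : (Fin 2 → ℂ) × (Fin 2 → ℂ) :=
  (![unitExp (x * r), unitExp (x * (a + 1 - r))], ![1, unitExp (x * a)])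

/-- The space `V_Ω(Λ)` spanned by `φ_Ω(Λ)`. -/
def spectralSpan (r a : ℝ) (Λ : Set ℝ) : Submodule ℂ ((Fin 2 → ℂ) × (Fin 2 → ℂ)) :=
  Submodule.span ℂ (embed r a '' Λ)

end Fuglede

end

namespace Fuglede

/-! Orthogonality makes every difference `x` of frequencies satisfy `e(xr) + e(x(a+1-r)) = 1 +
e(xa)`. Equal sums of two unimodular numbers force equal pairs or zero sums, so either `x` is an
integer, or `e(xa) = -1` and `e(x(1-2r)) = 1` (`zeros_cases`). Completeness excludes linear
relations: if `∑ cᵢ e((l-l₀)tᵢ) = 0` for all `l ∈ Λ`, and the shifts `tᵢ` carry one interval to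
disjoint parts of `Ω`, then a step function is orthogonal to every exponential, so all `cᵢ` vanish
(`coeff_eq_zero`). When all differences are integers, this forces `a - r ∈ ℤ`, and `Ω` is a unit
interval modulo `1`. Otherwise `Λ` splits into two classes, and suitable relations force `r = 1/2`
and `a ∈ ½ℤ` (`int_or_half`). Both shapes tile explicitly. -/

/-! ### Unimodular numbers. -/

theorem unitExp_eq_exp (t : ℝ) :
    unitExp t = Complex.exp ((2 * Real.pi * t : ℝ) * Complex.I) := by
  unfold unitExp; congr 1; push_cast; ring

theorem unitExp_add (s t : ℝ) : unitExp (s + t) = unitExp s * unitExp t := by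
  unfold unitExp; rw [← Complex.exp_add]; congr 1; push_cast; ring

@[simp] theorem unitExp_zero : unitExp 0 = 1 := by simp [unitExp]

@[simp] theorem norm_unitExp (t : ℝ) : ‖unitExp t‖ = 1 := by
  rw [unitExp_eq_exp, Complex.norm_exp_ofReal_mul_I]

theorem unitExp_ne_zero (t : ℝ) : unitExp t ≠ 0 := Complex.exp_ne_zero _

theorem conj_unitExp (t : ℝ) : (starRingEnd ℂ) (unitExp t) = unitExp (-t) := by
  rw [unitExp_eq_exp, unitExp_eq_exp, ← Complex.exp_conj, map_mul, Complex.conj_ofReal,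
    Complex.conj_I]
  congr 1; push_cast; ring

theorem unitExp_sub (s t : ℝ) : unitExp (s - t) = unitExp s / unitExp t := by
  rw [eq_div_iff (unitExp_ne_zero t), ← unitExp_add]; simp

theorem unitExp_eq_one_iff {t : ℝ} : unitExp t = 1 ↔ ∃ n : ℤ, t = n := by
  unfold unitExp; rw [Complex.exp_eq_one_iff]
  have h : (2 * (Real.pi : ℂ) * Complex.I) ≠ 0 := Complex.two_pi_I_ne_zero
  refine exists_congr fun n => ?_
  rw [mul_comm (n : ℂ), mul_right_inj' h]
  exact_mod_cast Iff.rfl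

theorem unitExp_half : unitExp (1 / 2) = -1 := by
  rw [← Complex.exp_pi_mul_I]; unfold unitExp; congr 1; push_cast; ring

theorem unitExp_eq_neg_one_iff {t : ℝ} : unitExp t = -1 ↔ ∃ n : ℤ, t = n + 1 / 2 := by
  have : unitExp t = -1 ↔ unitExp (t - 1 / 2) = 1 := by
    rw [unitExp_sub, unitExp_half, div_neg, div_one, neg_eq_iff_eq_neg]
  rw [this, unitExp_eq_one_iff]
  refine exists_congr fun n => ?_
  constructor <;> intro h <;> linarith

theorem continuous_unitExp : Continuous unitExp := by
  unfold unitExp; fun_prop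

/-- If two pairs of unimodular numbers have equal sums, the pairs agree or both sums vanish. -/
theorem eq_or_neg_of_add_eq_one_add {z w v : ℂ} (hz : ‖z‖ = 1) (hw : ‖w‖ = 1) (hv : ‖v‖ = 1)
    (h : z + w = 1 + v) : (z = 1 ∧ w = v) ∨ (z = v ∧ w = 1) ∨ (v = -1 ∧ w = -z) := by
  by_cases hv1 : v = -1
  · right; right; refine ⟨hv1, ?_⟩
    rw [hv1] at h; linear_combination h
  have e (x : ℂ) (hx : ‖x‖ = 1) : x * (starRingEnd ℂ) x = 1 := by
    rw [Complex.mul_conj, Complex.normSq_eq_norm_sq, hx]; simp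
  have hc : (starRingEnd ℂ) z + (starRingEnd ℂ) w = 1 + (starRingEnd ℂ) v := by
    simpa using congrArg (starRingEnd ℂ) h
  -- Conjugation inverts unimodular numbers, so equal sums also have equal products unless both sums
  -- vanish.
  have hp : (1 + v) * (z * w - v) = 0 := by
    linear_combination v * w * e z hz + v * z * e w hw - z * w * e v hv
      - (z * w * v) * hc + v * h
  have hS : 1 + v ≠ 0 := fun h0 => hv1 (by linear_combination h0)
  have hp' : z * w = v := by linear_combination (mul_eq_zero.1 hp).resolve_left hS
  have hq : (z - 1) * (z - v) = 0 := by linear_combination z * h - hp'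
  rcases mul_eq_zero.1 hq with h1 | h1
  · have : z = 1 := by linear_combination h1
    left; refine ⟨this, ?_⟩; rw [this] at h; linear_combination h
  · have : z = v := by linear_combination h1
    right; left; refine ⟨this, ?_⟩; rw [this] at h; linear_combination h

/-! ### Orthogonality and completeness on `Ω`. -/

theorem measurableSet_twoIntervals (r a : ℝ) : MeasurableSet (twoIntervals r a) :=
  measurableSet_Icc.union measurableSet_Icc

theorem disjoint_Icc_of_lt {r a : ℝ} (hra : r < a) (b : ℝ) :
    Disjoint (Set.Icc 0 r) (Set.Icc a b) :=
  Set.disjoint_left.2 fun _ h h' => absurd (h'.1.trans h.2) (not_le.2 hra)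

theorem volume_twoIntervals {r a : ℝ} (hr0 : 0 < r) (hr1 : r < 1) (hra : r < a) :
    volume (twoIntervals r a) = 1 := by
  rw [twoIntervals, measure_union (disjoint_Icc_of_lt hra _) measurableSet_Icc,
    Real.volume_Icc, Real.volume_Icc, ← ENNReal.ofReal_add (by linarith) (by linarith)]
  ring_nf; simp

theorem normExp_twoIntervals {r a : ℝ} (hr0 : 0 < r) (hr1 : r < 1) (hra : r < a) (l : ℝ) :
    normExp (twoIntervals r a) l =ᵐ[volume.restrict (twoIntervals r a)]
      fun x => unitExp (l * x) := by
  filter_upwards [ae_restrict_mem (measurableSet_twoIntervals r a)] with x hx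
  simp only [normExp, Set.indicator_of_mem hx, measureReal_def, volume_twoIntervals hr0 hr1 hra]
  simp [unitExp, mul_assoc]

instance isFiniteMeasure_twoIntervals (r a : ℝ) :
    IsFiniteMeasure (volume.restrict (twoIntervals r a)) :=
  ⟨by
    rw [Measure.restrict_apply_univ]
    exact (measure_union_le _ _).trans_lt (by simp [ENNReal.add_lt_top])⟩

/-- The exponentials of a spectrum are complete. -/
theorem IsSpectralPair.ae_eq_zero {r a : ℝ} (hr0 : 0 < r) (hr1 : r < 1) (hra : r < a)
    {Λ : Set ℝ} (h : IsSpectralPair (twoIntervals r a) Λ) {f : ℝ → ℂ}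
    (hf : MemLp f 2 (volume.restrict (twoIntervals r a)))
    (h0 : ∀ l ∈ Λ, ∫ x in twoIntervals r a, unitExp (-(l * x)) * f x = 0) :
    f =ᵐ[volume.restrict (twoIntervals r a)] 0 := by
  obtain ⟨b, hb⟩ := h.exists_basis
  have hz : hf.toLp f = 0 := by
    have : b.repr (hf.toLp f) = 0 := by
      ext l
      rw [HilbertBasis.repr_apply_apply, L2.inner_def]
      simp only [lp.coeFn_zero, Pi.zero_apply]
      rw [← h0 l l.2]
      refine integral_congr_ae ?_
      filter_upwards [hb l, normExp_twoIntervals hr0 hr1 hra l, hf.coeFn_toLp] with x h1 h2 h3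
      rw [h1, h2, h3, RCLike.inner_apply, conj_unitExp, mul_comm]
    simpa using this
  have := hf.coeFn_toLp
  rw [hz] at this
  exact this.symm.trans (Lp.coeFn_zero _ _ _)

theorem integral_unitExp_mul (x u v : ℝ) :
    2 * (Real.pi : ℂ) * Complex.I * x * ∫ t in u..v, unitExp (x * t) =
      unitExp (x * v) - unitExp (x * u) := by
  by_cases hx : x = 0
  · simp [hx]
  have hc : 2 * (Real.pi : ℂ) * Complex.I * x ≠ 0 :=
    mul_ne_zero Complex.two_pi_I_ne_zero (by exact_mod_cast hx)
  have : (fun t : ℝ => unitExp (x * t)) =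
      fun t : ℝ => Complex.exp (2 * (Real.pi : ℂ) * Complex.I * x * t) := by
    funext t; unfold unitExp; congr 1; push_cast; ring
  rw [this, integral_exp_mul_complex hc, mul_div_cancel₀ _ hc]
  unfold unitExp; push_cast; ring_nf

theorem integral_twoIntervals {r a : ℝ} (hr0 : 0 < r) (hr1 : r < 1) (hra : r < a) (x : ℝ) :
    2 * (Real.pi : ℂ) * Complex.I * x * ∫ t in twoIntervals r a, unitExp (x * t) =
      unitExp (x * r) + unitExp (x * (a + 1 - r)) - (1 + unitExp (x * a)) := by
  have hi (u v : ℝ) : IntegrableOn (fun t => unitExp (x * t)) (Set.Icc u v) :=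
    (continuous_unitExp.comp (continuous_const.mul continuous_id)).continuousOn.integrableOn_Icc
  rw [twoIntervals, setIntegral_union (disjoint_Icc_of_lt hra _) measurableSet_Icc (hi _ _)
    (hi _ _), integral_Icc_eq_integral_Ioc, integral_Icc_eq_integral_Ioc,
    ← intervalIntegral.integral_of_le hr0.le,
    ← intervalIntegral.integral_of_le (by linarith), mul_add, integral_unitExp_mul,
    integral_unitExp_mul]
  simp; ring

/-- Differences of elements of a spectrum are zeros of the Fourier transform of `χ_Ω`. -/
theorem IsSpectralPair.unitExp_add_eq {r a : ℝ} (hr0 : 0 < r) (hr1 : r < 1) (hra : r < a)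
    {Λ : Set ℝ} (h : IsSpectralPair (twoIntervals r a) Λ) {l m : ℝ} (hl : l ∈ Λ) (hm : m ∈ Λ) :
    unitExp ((l - m) * r) + unitExp ((l - m) * (a + 1 - r)) = 1 + unitExp ((l - m) * a) := by
  by_cases hlm : l = m
  · simp [hlm]
  obtain ⟨b, hb⟩ := h.exists_basis
  have ho := b.orthonormal.2 (i := ⟨m, hm⟩) (j := ⟨l, hl⟩) (by simpa using Ne.symm hlm)
  simp only [L2.inner_def] at ho
  have he : ∫ t in twoIntervals r a, unitExp ((l - m) * t) = 0 := by
    rw [← ho]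
    refine integral_congr_ae ?_
    filter_upwards [hb ⟨l, hl⟩, hb ⟨m, hm⟩, normExp_twoIntervals hr0 hr1 hra l,
      normExp_twoIntervals hr0 hr1 hra m] with x h1 h2 h3 h4
    rw [h1, h2, h3, h4, RCLike.inner_apply, conj_unitExp, ← unitExp_add]
    ring_nf
  have := integral_twoIntervals hr0 hr1 hra (l - m)
  rw [he, mul_zero] at this
  exact (sub_eq_zero.1 this.symm)

/-- The exponentials of a spectrum satisfy no linear relation at the points of a finite set of
translations that moves an interval to disjoint parts of `Ω`. -/
theorem IsSpectralPair.coeff_eq_zero {r a : ℝ} (hr0 : 0 < r) (hr1 : r < 1) (hra : r < a)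
    {Λ : Set ℝ} (h : IsSpectralPair (twoIntervals r a) Λ) {ι : Type*} [Fintype ι]
    (t : ι → ℝ) (c : ι → ℂ) {u v : ℝ} (huv : u < v)
    (hsub : ∀ i, Set.Ioc (u + t i) (v + t i) ⊆ twoIntervals r a)
    (hdisj : ∀ i j, i ≠ j → Disjoint (Set.Ioc (u + t i) (v + t i)) (Set.Ioc (u + t j) (v + t j)))
    (l₀ : ℝ) (hc : ∀ l ∈ Λ, ∑ i, c i * unitExp ((l - l₀) * t i) = 0) (i : ι) : c i = 0 := by
  set Ω := twoIntervals r a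
  set J : ι → Set ℝ := fun i => Set.Ioc (u + t i) (v + t i)
  -- With these weights, the integral of `e(-lx) f(x)` is the conjugate of the given relation times
  -- the integral over the base interval.
  set d : ι → ℂ := fun i => (starRingEnd ℂ) (c i) * unitExp (l₀ * t i)
  set f : ℝ → ℂ := fun x => ∑ i, (J i).indicator (fun _ => d i) x
  have hJ (i : ι) : MeasurableSet (J i) := measurableSet_Ioc
  have hf : MemLp f 2 (volume.restrict Ω) :=
    memLp_finsetSum _ fun i _ => (memLp_const (d i)).indicator (hJ i)
  have hg (l : ℝ) : Continuous fun x => unitExp (-(l * x)) :=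
    continuous_unitExp.comp (by fun_prop)
  have h1 (l : ℝ) (i : ι) : ∫ x in Ω, unitExp (-(l * x)) * (J i).indicator (fun _ => d i) x =
      (d i * unitExp (-(l * t i))) * ∫ x in u..v, unitExp (-(l * x)) := by
    have e1 : (fun x => unitExp (-(l * x)) * (J i).indicator (fun _ => d i) x) =
        (J i).indicator fun x => unitExp (-(l * x)) * d i := by
      funext x; by_cases hx : x ∈ J i <;> simp [hx]
    rw [e1, setIntegral_indicator (hJ i), Set.inter_eq_right.2 (hsub i),
      ← intervalIntegral.integral_of_le (by linarith),
      ← intervalIntegral.integral_comp_add_right (fun x => unitExp (-(l * x)) * d i) (t i),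
      ← intervalIntegral.integral_const_mul]
    congr 1; funext x
    rw [mul_add, neg_add, unitExp_add]; ring
  have h0 : ∀ l ∈ Λ, ∫ x in Ω, unitExp (-(l * x)) * f x = 0 := by
    intro l hl
    simp only [f, Finset.mul_sum]
    rw [integral_finsetSum]
    · simp only [h1, ← Finset.sum_mul]
      have : ∑ i, d i * unitExp (-(l * t i)) =
          (starRingEnd ℂ) (∑ i, c i * unitExp ((l - l₀) * t i)) := by
        rw [map_sum]
        refine Finset.sum_congr rfl fun i _ => ?_
        rw [map_mul, conj_unitExp, mul_assoc, ← unitExp_add]; ring_nf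
      rw [this, hc l hl]; simp
    · intro i _
      have := ((integrable_const (μ := volume.restrict Ω) (d i)).indicator (hJ i)).bdd_mul
        (c := 1) (hg l).aestronglyMeasurable (Filter.Eventually.of_forall fun x => by simp)
      exact this
  have hz := h.ae_eq_zero hr0 hr1 hra hf h0
  have hzJ := ae_restrict_of_ae_restrict_of_subset (hsub i) hz
  have hfJ : ∀ x ∈ J i, f x = d i := by
    intro x hx
    simp only [f]
    rw [Finset.sum_eq_single i]
    · simp [hx]
    · intro j _ hj
      exact Set.indicator_of_notMem (Set.disjoint_left.1 (hdisj i j hj.symm) hx) _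
    · simp
  by_contra hci
  have hd : d i ≠ 0 := mul_ne_zero (by simpa using hci) (unitExp_ne_zero _)
  have hfalse : ∀ᵐ x ∂(volume.restrict (J i)), False := by
    filter_upwards [hzJ, ae_restrict_mem (hJ i)] with x hx hxJ
    exact hd ((hfJ x hxJ).symm.trans hx)
  rw [Filter.eventually_false_iff_eq_bot, ae_eq_bot, Measure.restrict_eq_zero,
    Real.volume_Ioc] at hfalse
  simp only [ENNReal.ofReal_eq_zero] at hfalse
  linarith

/-- The bounds on `t` say that `[0, r] + t` overlaps `[a, a+1-r]` in positive length. A shift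
invisible to all frequencies would give the relation with coefficients `1, -1`. -/
theorem IsSpectralPair.exists_unitExp_ne_one {r a : ℝ} (hr0 : 0 < r) (hr1 : r < 1) (hra : r < a)
    {Λ : Set ℝ} (h : IsSpectralPair (twoIntervals r a) Λ) {t : ℝ} (ht : a - r < t)
    (ht' : t < a + 1 - r) (l₀ : ℝ) : ∃ l ∈ Λ, unitExp ((l - l₀) * t) ≠ 1 := by
  by_contra! hc
  have h1 : max 0 (a - t) < min r (a + 1 - r - t) := by
    simp only [lt_min_iff, max_lt_iff]
    refine ⟨⟨?_, ?_⟩, ?_, ?_⟩ <;> linarith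
  have hu1 := le_max_left 0 (a - t)
  have hu2 := le_max_right 0 (a - t)
  have hv1 := min_le_left r (a + 1 - r - t)
  have hv2 := min_le_right r (a + 1 - r - t)
  set u := max 0 (a - t)
  set v := min r (a + 1 - r - t)
  have hd : Disjoint (Set.Ioc (u + 0) (v + 0)) (Set.Ioc (u + t) (v + t)) :=
    Set.disjoint_left.2 fun x hx hx' => by
      have := hx.2; have := hx'.1; linarith
  have := h.coeff_eq_zero hr0 hr1 hra ![0, t] ![1, -1] h1 ?_ ?_ l₀ ?_ 0
  · simp at this
  · intro i x hx
    fin_cases i <;> simp at hx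
    · left; constructor <;> linarith
    · right; constructor <;> linarith
  · intro i j hij
    fin_cases i <;> fin_cases j <;> first | exact absurd rfl hij | exact hd | exact hd.symm
  · intro l hl
    simp [Fin.sum_univ_two, hc l hl]

/-! ### Arithmetic of the frequencies. -/

/-- The real zeros of the Fourier transform of `χ_Ω`. -/
theorem zeros_cases {r a x : ℝ}
    (h : unitExp (x * r) + unitExp (x * (a + 1 - r)) = 1 + unitExp (x * a)) :
    ((∃ n : ℤ, x = n) ∧ ∃ n : ℤ, x * r = n) ∨
    ((∃ n : ℤ, x = n) ∧ ∃ n : ℤ, x * (a - r) = n) ∨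
    (unitExp (x * a) = -1 ∧ unitExp (x * (1 - 2 * r)) = 1) := by
  rcases eq_or_neg_of_add_eq_one_add (norm_unitExp _) (norm_unitExp _) (norm_unitExp _) h with
    ⟨h1, h2⟩ | ⟨h1, h2⟩ | ⟨h1, h2⟩
  · left
    rw [← div_eq_one_iff_eq (unitExp_ne_zero _), ← unitExp_sub, unitExp_eq_one_iff] at h2
    obtain ⟨n, hn⟩ := unitExp_eq_one_iff.1 h1
    obtain ⟨m, hm⟩ := h2
    exact ⟨⟨n + m, by push_cast; linarith⟩, n, hn⟩
  · right; left
    rw [← div_eq_one_iff_eq (unitExp_ne_zero _), ← unitExp_sub, unitExp_eq_one_iff] at h1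
    obtain ⟨n, hn⟩ := h1
    obtain ⟨m, hm⟩ := unitExp_eq_one_iff.1 h2
    exact ⟨⟨n + m, by push_cast; linarith⟩, -n, by push_cast; linarith⟩
  · right; right
    refine ⟨h1, ?_⟩
    have : x * (1 - 2 * r) = x * (a + 1 - r) - x * r - x * a := by ring
    rw [this, unitExp_sub, unitExp_sub, h1, h2, neg_div, div_self (unitExp_ne_zero _)]
    norm_num

/-- If all frequencies are congruent modulo `1`, the two intervals fit together modulo `1`. -/
theorem IsSpectralPair.exists_int_sub_eq {r a : ℝ} (hr0 : 0 < r) (hr1 : r < 1) (hra : r < a)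
    {Λ : Set ℝ} (h : IsSpectralPair (twoIntervals r a) Λ) {l₀ : ℝ}
    (hZ : ∀ l ∈ Λ, ∃ n : ℤ, l - l₀ = n) : ∃ m : ℤ, a - r = m := by
  by_contra! hm
  have hlt := lt_of_le_of_ne (Int.floor_le (a - r)) (hm _).symm
  have hlt' := Int.lt_floor_add_one (a - r)
  have hne := hm (⌊a - r⌋ + 1)
  -- The least integer above `a - r` is a forbidden shift: integer differences cannot see it.
  by_cases hcase : (⌊a - r⌋ : ℝ) + 1 < a + 1 - r
  · obtain ⟨l, hl, hne⟩ := h.exists_unitExp_ne_one hr0 hr1 hra hlt' hcase l₀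
    obtain ⟨n, hn⟩ := hZ l hl
    exact hne (unitExp_eq_one_iff.2 ⟨n * (⌊a - r⌋ + 1), by rw [hn]; push_cast; ring⟩)
  · exact absurd hlt (by linarith)

/-- If some multiple `k • s` with `|s| < 1` avoids the relevant interval, then `s = 0`. -/
theorem IsSpectralPair.eq_zero_of_unitExp_eq_one {r a : ℝ} (hr0 : 0 < r) (hr1 : r < 1)
    (hra : r < a) {Λ : Set ℝ} (h : IsSpectralPair (twoIntervals r a) Λ) {l₀ s : ℝ} (hs : |s| < 1)
    (h1 : ∀ l ∈ Λ, unitExp ((l - l₀) * s) = 1) : s = 0 := by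
  by_contra hs0
  have hpos : 0 < |s| := abs_pos.2 hs0
  have hZ (l : ℝ) (hl : l ∈ Λ) : ∃ n : ℤ, (l - l₀) * |s| = n := by
    obtain ⟨n, hn⟩ := unitExp_eq_one_iff.1 (h1 l hl)
    rcases abs_choice s with hh | hh
    · exact ⟨n, by rw [hh, hn]⟩
    · exact ⟨-n, by rw [hh]; push_cast; linarith⟩
  -- Steps of size `|s| < 1` cannot jump over the interval `(a - r, a + 1 - r)` of length `1`.
  set k : ℤ := ⌊(a - r) / |s|⌋ + 1
  have hk1 : a - r < k * |s| := by
    rw [← div_lt_iff₀ hpos]; push_cast [k]; exact Int.lt_floor_add_one _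
  have hk2 : k * |s| < a + 1 - r := by
    have : ((k : ℝ) - 1) * |s| ≤ a - r := by
      rw [← le_div_iff₀ hpos]; push_cast [k]; simpa using Int.floor_le _
    linarith
  obtain ⟨l, hl, hne⟩ := h.exists_unitExp_ne_one hr0 hr1 hra hk1 hk2 l₀
  obtain ⟨n, hn⟩ := hZ l hl
  exact hne (unitExp_eq_one_iff.2 ⟨k * n, by push_cast; rw [← hn]; ring⟩)

theorem exists_eq_div_two_or_mem_Ioo (a : ℝ) :
    (∃ n : ℤ, a = n / 2) ∨ ∃ j : ℤ, 0 < a - j / 2 ∧ a - j / 2 < 1 / 2 := by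
  have h1 := Int.floor_le (2 * a)
  have h2 := Int.lt_floor_add_one (2 * a)
  rcases h1.eq_or_lt with h | h
  · exact Or.inl ⟨⌊2 * a⌋, by linarith⟩
  · exact Or.inr ⟨⌊2 * a⌋, by linarith, by linarith⟩

/-- A spectrum is congruent to a point modulo `1`, or the intervals have equal lengths and
half-integral distance. -/
theorem IsSpectralPair.int_or_half {r a : ℝ} (hr0 : 0 < r) (hr1 : r < 1) (hra : r < a)
    {Λ : Set ℝ} (h : IsSpectralPair (twoIntervals r a) Λ) {l₀ : ℝ} (hl₀ : l₀ ∈ Λ) :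
    (∀ l ∈ Λ, ∃ n : ℤ, l - l₀ = n) ∨ (r = 1 / 2 ∧ ∃ n : ℤ, a = (n : ℝ) / 2) := by
  by_cases hZ : ∀ l ∈ Λ, ∃ n : ℤ, l - l₀ = n
  · exact Or.inl hZ
  right
  push Not at hZ
  obtain ⟨l₁, hl₁, hne⟩ := hZ
  have key {l m : ℝ} (hl : l ∈ Λ) (hm : m ∈ Λ) := zeros_cases (h.unitExp_add_eq hr0 hr1 hra hl hm)
  have non {l m : ℝ} (hl : l ∈ Λ) (hm : m ∈ Λ) (hn : ∀ n : ℤ, l - m ≠ n) :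
      unitExp ((l - m) * a) = -1 ∧ unitExp ((l - m) * (1 - 2 * r)) = 1 := by
    rcases key hl hm with ⟨⟨n, h1⟩, -⟩ | ⟨⟨n, h1⟩, -⟩ | h1
    · exact absurd h1 (hn n)
    · exact absurd h1 (hn n)
    · exact h1
  have h01 := non hl₁ hl₀ hne
  have split {l m k : ℝ} (s : ℝ) :
      unitExp ((l - k) * s) = unitExp ((l - m) * s) * unitExp ((m - k) * s) := by
    rw [← unitExp_add]; ring_nf
  -- every frequency lies in one of the two classes
  have cls (l : ℝ) (hl : l ∈ Λ) :
      ((∃ n : ℤ, l - l₀ = n) ∧ unitExp ((l - l₀) * a) = 1 ∧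
        unitExp ((l - l₀) * (1 - 2 * r)) = 1) ∨
      ((∃ n : ℤ, l - l₁ = n) ∧ unitExp ((l - l₁) * a) = 1 ∧
        unitExp ((l - l₁) * (1 - 2 * r)) = 1) := by
    by_cases hi : ∃ n : ℤ, l - l₀ = n
    · left
      refine ⟨hi, ?_⟩
      obtain ⟨n, hn⟩ := hi
      -- Here `l₁ - l` is not an integer either, so the two values `-1` cancel.
      have h2 := non hl₁ hl fun m hm => hne (m + n) (by push_cast; linarith)
      have e1 := split (l := l₁) (m := l) (k := l₀) a
      have e2 := split (l := l₁) (m := l) (k := l₀) (1 - 2 * r)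
      rw [h01.1, h2.1] at e1
      rw [h01.2, h2.2] at e2
      exact ⟨by linear_combination e1, by linear_combination -e2⟩
    · push Not at hi
      right
      have h2 := non hl hl₀ hi
      have e1 := split (l := l) (m := l₁) (k := l₀) a
      have e2 := split (l := l) (m := l₁) (k := l₀) (1 - 2 * r)
      rw [h01.1, h2.1] at e1
      rw [h01.2, h2.2] at e2
      have e3 : unitExp ((l - l₁) * a) = 1 := by linear_combination e1
      refine ⟨?_, e3, by linear_combination -e2⟩
      rcases key hl hl₁ with ⟨h1, -⟩ | ⟨h1, -⟩ | h1
      · exact h1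
      · exact h1
      · rw [e3] at h1; norm_num at h1
  have hr : r = 1 / 2 := by
    have : 1 - 2 * r = 0 := by
      refine h.eq_zero_of_unitExp_eq_one hr0 hr1 hra (l₀ := l₀)
        (by rw [abs_lt]; constructor <;> linarith) fun l hl => ?_
      rcases cls l hl with ⟨-, -, h1⟩ | ⟨-, -, h1⟩
      · exact h1
      · rw [split (m := l₁), h1, h01.2, one_mul]
    linarith
  refine ⟨hr, ?_⟩
  subst hr
  rcases exists_eq_div_two_or_mem_Ioo a with hh | ⟨j, hs0, hs1⟩
  · exact hh
  exfalso
  -- Differences within a class are even integers, so `s` and `a` look alike to them.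
  set s := a - j / 2 with hs
  have even {l m : ℝ} (hl : l ∈ Λ) (hm : m ∈ Λ) (h1 : unitExp ((l - m) * a) = 1) :
      unitExp ((l - m) * s) = 1 := by
    have : ∃ n : ℤ, (l - m) * (1 / 2) = n := by
      rcases key hl hm with ⟨-, h2⟩ | ⟨-, n, h2⟩ | h2
      · exact h2
      · obtain ⟨k, hk⟩ := unitExp_eq_one_iff.1 h1
        exact ⟨k - n, by push_cast; linarith⟩
      · rw [h1] at h2; norm_num at h2
    obtain ⟨n, hn⟩ := this
    obtain ⟨k, hk⟩ := unitExp_eq_one_iff.1 h1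
    refine unitExp_eq_one_iff.2 ⟨k - j * n, ?_⟩
    push_cast; rw [← hn, ← hk, hs]; ring
  set w := unitExp ((l₁ - l₀) * s) with hw
  have hε : 0 < min s (1 / 2 - s) := lt_min hs0 (by linarith)
  have hε1 := min_le_left s (1 / 2 - s)
  have hε2 := min_le_right s (1 / 2 - s)
  set ε := min s (1 / 2 - s)
  have d01 : Disjoint (Set.Ioc (0 + 0) (ε + 0)) (Set.Ioc (0 + s) (ε + s)) :=
    Set.disjoint_left.2 fun x hx hx' => by have := hx.2; have := hx'.1; linarith
  have d02 : Disjoint (Set.Ioc (0 + 0) (ε + 0)) (Set.Ioc (0 + a) (ε + a)) :=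
    Set.disjoint_left.2 fun x hx hx' => by have := hx.2; have := hx'.1; linarith
  have d12 : Disjoint (Set.Ioc (0 + s) (ε + s)) (Set.Ioc (0 + a) (ε + a)) :=
    Set.disjoint_left.2 fun x hx hx' => by have := hx.2; have := hx'.1; linarith
  -- The two classes take the values `(1, 1, 1)` and `(1, w, -1)` at the shifts `0, s, a`. The
  -- coefficients are their cross product, whose middle entry `2` is nonzero.
  have := h.coeff_eq_zero hr0 hr1 hra ![0, s, a] ![-1 - w, 2, w - 1] hε ?_ ?_ l₀ ?_ 1
  · simp at this
  · intro i x hx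
    fin_cases i <;> simp at hx
    · left; constructor <;> linarith
    · left; constructor <;> linarith
    · right; constructor <;> linarith
  · intro i j hij
    fin_cases i <;> fin_cases j <;>
      first
      | exact absurd rfl hij
      | exact d01
      | exact d02
      | exact d12
      | exact d01.symm
      | exact d02.symm
      | exact d12.symm
  · intro l hl
    simp only [Fin.sum_univ_three, Matrix.cons_val_zero, Matrix.cons_val_one, Matrix.cons_val,
      mul_zero, unitExp_zero, mul_one]
    rcases cls l hl with ⟨-, h1, -⟩ | ⟨-, h1, -⟩
    · rw [h1, even hl hl₀ h1]; ring
    · rw [split (m := l₁) a, h1, h01.1, split (m := l₁) s, even hl hl₁ h1, ← hw]; ring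

/-- Since `a - r ∈ ℤ`, distinct integer frequencies are orthogonal on `Ω`; a missing one would
contradict completeness. -/
theorem IsSpectralPair.eq_integers {r a : ℝ} (hr0 : 0 < r) (hr1 : r < 1) (hra : r < a)
    {Λ : Set ℝ} (h : IsSpectralPair (twoIntervals r a) Λ) (hΛ : Λ ⊆ integers) {m : ℤ}
    (hm : a - r = m) : Λ = integers := by
  refine hΛ.antisymm ?_
  rintro _ ⟨n, rfl⟩
  by_contra hn
  simp only at hn
  have hc : Continuous fun x : ℝ => unitExp (n * x) := continuous_unitExp.comp (by fun_prop)
  have hf : MemLp (fun x : ℝ => unitExp (n * x)) 2 (volume.restrict (twoIntervals r a)) :=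
    MemLp.of_bound hc.aestronglyMeasurable 1 (Filter.Eventually.of_forall fun x => by simp)
  have h0 := h.ae_eq_zero hr0 hr1 hra hf ?_
  · have hF : ∀ᵐ x ∂(volume.restrict (twoIntervals r a)), False := by
      filter_upwards [h0] with x hx
      exact unitExp_ne_zero _ hx
    rw [Filter.eventually_false_iff_eq_bot, ae_eq_bot, Measure.restrict_eq_zero,
      volume_twoIntervals hr0 hr1 hra] at hF
    exact one_ne_zero hF
  · intro l hl
    obtain ⟨k, rfl⟩ := hΛ hl
    have hx : ((n : ℝ) - k) ≠ 0 := fun h => hn (by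
      have : (n : ℝ) = k := by linarith
      rw [this]; exact hl)
    have hI := integral_twoIntervals hr0 hr1 hra ((n : ℝ) - k)
    have e1 : unitExp (((n : ℝ) - k) * (a + 1 - r)) = 1 :=
      unitExp_eq_one_iff.2 ⟨(n - k) * (m + 1), by push_cast; rw [← hm]; ring⟩
    have e2 : unitExp (((n : ℝ) - k) * a) = unitExp (((n : ℝ) - k) * r) := by
      rw [← div_eq_one_iff_eq (unitExp_ne_zero _), ← unitExp_sub]
      exact unitExp_eq_one_iff.2 ⟨(n - k) * m, by push_cast; rw [← hm]; ring⟩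
    rw [e1, e2, add_comm, sub_self] at hI
    have := (mul_eq_zero.1 hI).resolve_left
      (mul_ne_zero Complex.two_pi_I_ne_zero (by exact_mod_cast hx))
    rw [← this]
    congr 1; funext x
    rw [← unitExp_add]; ring_nf

/-! ### Explicit tilings. -/

theorem mem_translate {T : Set ℝ} {t x : ℝ} : x ∈ translate T t ↔ x - t ∈ T :=
  ⟨fun ⟨y, hy, h⟩ => by rw [← h]; simpa using hy, fun h => ⟨x - t, h, by simp⟩⟩

/-- A tiling criterion that ignores a countable set of points. -/
theorem IsTilingPair.of_countable {r a : ℝ} (hr0 : 0 < r) (hr1 : r < 1) (hra : r < a) {S : Set ℝ}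
    {C : Set ℝ} (hC : C.Countable)
    (hd : ∀ s ∈ S, ∀ t ∈ S, ∀ x ∉ C, x - s ∈ twoIntervals r a → x - t ∈ twoIntervals r a → s = t)
    (hcov : ∀ x, ∃ t ∈ S, x - t ∈ twoIntervals r a) : IsTilingPair (twoIntervals r a) S where
  nullMeasurableSet := (measurableSet_twoIntervals r a).nullMeasurableSet
  measure_pos := by rw [volume_twoIntervals hr0 hr1 hra]; exact one_pos
  measure_lt_top := by rw [volume_twoIntervals hr0 hr1 hra]; exact ENNReal.one_lt_top
  aedisjoint s hs t ht hst := by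
    refine measure_mono_null (fun x hx => ?_) (hC.measure_zero volume)
    by_contra hxC
    exact hst (hd s hs t ht x hxC (mem_translate.1 hx.1) (mem_translate.1 hx.2))
  ae_covers := Filter.Eventually.of_forall fun x => by
    obtain ⟨t, ht, hx⟩ := hcov x
    exact ⟨t, ht, mem_translate.2 hx⟩

/-- Modulo `1` the second interval is `[r, 1]`. Overlaps occur only at the endpoints, which lie in
`ℤ ∪ (ℤ + r)`. -/
theorem isTilingPair_integers {r a : ℝ} (hr0 : 0 < r) (hr1 : r < 1) (hra : r < a) {m : ℤ}
    (hm : a - r = m) : IsTilingPair (twoIntervals r a) integers := by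
  have ha : a = m + r := by linarith
  refine IsTilingPair.of_countable hr0 hr1 hra (C := integers ∪ Set.range fun n : ℤ => (n : ℝ) + r)
    ((Set.countable_range _).union (Set.countable_range _)) ?_ ?_
  · have fl {n k : ℤ} (h1 : (n : ℝ) < k + 1) (h2 : (k : ℝ) < n + 1) : n = k := by
      have : n < k + 1 := by exact_mod_cast h1
      have : k < n + 1 := by exact_mod_cast h2
      omega
    have mixed {n k : ℤ} {x : ℝ} (hx : x ∉ integers ∪ Set.range fun n : ℤ => (n : ℝ) + r)
        (h1 : x - n ∈ Set.Icc 0 r) (h2 : x - k ∈ Set.Icc a (a + 1 - r)) : False := by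
      have e1 : x ≠ n := fun h => hx (Or.inl ⟨n, h.symm⟩)
      have e2 : x ≠ n + r := fun h => hx (Or.inr ⟨n, h.symm⟩)
      have h3 : x < n + r := lt_of_le_of_ne (by linarith [h1.2]) e2
      have h4 : n < x := lt_of_le_of_ne (by linarith [h1.1]) e1.symm
      have h5 := h2.1
      have h6 := h2.2
      have h7 : ((k + m : ℤ) : ℝ) < n := by push_cast; linarith
      have h8 : (n : ℝ) < (k + m : ℤ) + 1 := by push_cast; linarith
      have h7 : k + m < n := by exact_mod_cast h7
      have h8 : n < k + m + 1 := by exact_mod_cast h8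
      omega
    rintro _ ⟨n, rfl⟩ _ ⟨k, rfl⟩ x hx h1 h2
    simp only at h1 h2 ⊢
    rcases h1 with h1 | h1 <;> rcases h2 with h2 | h2
    · exact congrArg _ (fl (by linarith [h1.1, h2.2]) (by linarith [h2.1, h1.2]))
    · exact (mixed hx h1 h2).elim
    · exact (mixed hx h2 h1).elim
    · exact congrArg _ (fl (by linarith [h1.1, h2.2]) (by linarith [h2.1, h1.2]))
  · intro x
    have h1 := Int.floor_le x
    have h2 := Int.lt_floor_add_one x
    by_cases hx : x - ⌊x⌋ ≤ r
    · exact ⟨_, ⟨⌊x⌋, rfl⟩, Or.inl ⟨by simp, hx⟩⟩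
    · refine ⟨_, ⟨⌊x⌋ - m, rfl⟩, Or.inr ?_⟩
      push_cast
      constructor <;> linarith

theorem tilesByTranslation_half {a : ℝ} (ha : 1 / 2 < a) {n : ℤ} (hn : a = (n : ℝ) / 2) :
    TilesByTranslation (twoIntervals (1 / 2) a) := by
  have hn1 : 1 < n := by
    have : (1 : ℝ) < n := by linarith
    exact_mod_cast this
  -- In cells of length `1/2`, `Ω` occupies cells `0` and `n`. Shifting by residues below `n` modulo
  -- `2n` fills those residues with the first interval and the others with the second.
  refine ⟨{x | ∃ j : ℤ, x = j / 2 ∧ j % (2 * n) < n},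
    IsTilingPair.of_countable (by norm_num) (by norm_num) ha
    (C := Set.range fun j : ℤ => (j : ℝ) / 2) (Set.countable_range _) ?_ ?_⟩
  · have fl {x : ℝ} {j : ℤ} (hx : x ∉ Set.range fun j : ℤ => (j : ℝ) / 2)
        (h : x - j / 2 ∈ twoIntervals (1 / 2) a) : ⌊2 * x⌋ = j ∨ ⌊2 * x⌋ = j + n := by
      rcases h with h | h
      · left
        have : x ≠ (j + 1 : ℤ) / 2 := fun h => hx ⟨j + 1, h.symm⟩
        have := lt_of_le_of_ne (b := ((j + 1 : ℤ) : ℝ) / 2)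
          (by push_cast; linarith [h.2]) this
        push_cast at this
        rw [Int.floor_eq_iff]
        constructor <;> linarith [h.1]
      · right
        have : x ≠ (j + n + 1 : ℤ) / 2 := fun h => hx ⟨j + n + 1, h.symm⟩
        have := lt_of_le_of_ne (b := ((j + n + 1 : ℤ) : ℝ) / 2)
          (by push_cast; linarith [h.2]) this
        push_cast at this
        rw [Int.floor_eq_iff]
        push_cast
        constructor <;> linarith [h.1]
    have shift (j : ℤ) (h1 : j % (2 * n) < n) (h2 : (j + n) % (2 * n) < n) : False := by
      have h0 := Int.emod_nonneg j (b := 2 * n) (by omega)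
      rw [← Int.emod_add_emod, Int.emod_eq_of_lt (by omega) (by omega)] at h2
      omega
    rintro _ ⟨j, rfl, hj⟩ _ ⟨k, rfl, hk⟩ x hx h1 h2
    have : j = k := by
      rcases fl hx h1 with h1 | h1 <;> rcases fl hx h2 with h2 | h2
      · omega
      · exact (shift k hk (by rwa [← h2, h1])).elim
      · exact (shift j hj (by rwa [← h1, h2])).elim
      · omega
    rw [this]
  · intro x
    have h1 := Int.floor_le (2 * x)
    have h2 := Int.lt_floor_add_one (2 * x)
    set j := ⌊2 * x⌋
    by_cases hj : j % (2 * n) < n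
    · exact ⟨_, ⟨j, rfl, hj⟩, Or.inl ⟨by linarith, by linarith⟩⟩
    · refine ⟨_, ⟨j - n, rfl, ?_⟩, Or.inr ?_⟩
      · have h0 := Int.emod_lt_of_pos j (b := 2 * n) (by omega)
        rw [← Int.emod_sub_emod, Int.emod_eq_of_lt (by omega) (by omega)]
        omega
      · push_cast
        constructor <;> linarith

theorem IsSpectralPair.tilesByTranslation {r a : ℝ} (hr0 : 0 < r) (hr1 : r < 1) (hra : r < a)
    {Λ : Set ℝ} (h : IsSpectralPair (twoIntervals r a) Λ) :
    TilesByTranslation (twoIntervals r a) := by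
  -- Only nonemptiness of `Λ` is extracted here.
  obtain ⟨l₀, hl₀, -⟩ := h.exists_unitExp_ne_one hr0 hr1 hra (t := a) (by linarith)
    (by linarith) 0
  rcases h.int_or_half hr0 hr1 hra hl₀ with hZ | ⟨rfl, n, hn⟩
  · obtain ⟨m, hm⟩ := h.exists_int_sub_eq hr0 hr1 hra hZ
    exact ⟨_, isTilingPair_integers hr0 hr1 hra hm⟩
  · exact tilesByTranslation_half hra hn

/-! ### The null form and the dimension of the span. -/

theorem IsSpectralPair.isMutuallyNull {r a : ℝ} (hr0 : 0 < r) (hr1 : r < 1) (hra : r < a)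
    {Λ : Set ℝ} (h : IsSpectralPair (twoIntervals r a) Λ) :
    IsMutuallyNull (embed r a '' Λ) := by
  rintro _ ⟨l, hl, rfl⟩ _ ⟨m, hm, rfl⟩
  have := h.unitExp_add_eq hr0 hr1 hra hl hm
  simp only [sub_mul, unitExp_sub, div_eq_mul_inv] at this
  have hi (t : ℝ) : (starRingEnd ℂ) (unitExp t) = (unitExp t)⁻¹ := by
    rw [conj_unitExp, ← zero_sub, unitExp_sub, unitExp_zero, one_div]
  simp [nullForm, embed, dotProduct, Fin.sum_univ_two, hi, this]

theorem nullForm_eq_zero_of_mem_span {S : Set ((Fin 2 → ℂ) × (Fin 2 → ℂ))} (hS : IsMutuallyNull S)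
    {v w : (Fin 2 → ℂ) × (Fin 2 → ℂ)} (hv : v ∈ Submodule.span ℂ S)
    (hw : w ∈ Submodule.span ℂ S) : nullForm v w = 0 := by
  induction hv using Submodule.span_induction with
  | zero => simp [nullForm]
  | add x y _ _ hx hy =>
    have : nullForm (x + y) w = nullForm x w + nullForm y w := by
      simp [nullForm, add_dotProduct]; ring
    rw [this, hx, hy, add_zero]
  | smul c x _ hx =>
    have : nullForm (c • x) w = c * nullForm x w := by
      simp [nullForm, smul_dotProduct, mul_sub]
    rw [this, hx, mul_zero]
  | mem v hv =>
    induction hw using Submodule.span_induction with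
    | zero => simp [nullForm]
    | add x y _ _ hx hy =>
      have : nullForm v (x + y) = nullForm v x + nullForm v y := by
        simp [nullForm, dotProduct_add]; ring
      rw [this, hx, hy, add_zero]
    | smul c x _ hx =>
      have : nullForm v (c • x) = star c * nullForm v x := by
        simp [nullForm, dotProduct_smul, mul_sub]
      rw [this, hx, mul_zero]
    | mem w hw => exact hS v hv w hw

open scoped ComplexOrder in
/-- A totally isotropic subspace has dimension at most `2`. -/
theorem finrank_span_le_two {S : Set ((Fin 2 → ℂ) × (Fin 2 → ℂ))} (hS : IsMutuallyNull S) :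
    Module.finrank ℂ (Submodule.span ℂ S) ≤ 2 := by
  -- On an isotropic space `v.1` and `v.2` have equal norms, so `v.1 = 0` forces `v = 0`.
  have hinj : Function.Injective
      ((LinearMap.fst ℂ (Fin 2 → ℂ) (Fin 2 → ℂ)).comp (Submodule.span ℂ S).subtype) := by
    rw [← LinearMap.ker_eq_bot, LinearMap.ker_eq_bot']
    rintro ⟨v, hv⟩ h0
    have h1 : v.1 = 0 := h0
    have h2 := nullForm_eq_zero_of_mem_span hS hv hv
    simp only [nullForm, h1, zero_dotProduct, zero_sub, neg_eq_zero] at h2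
    have h3 : v.2 = 0 := dotProduct_self_star_eq_zero.1 h2
    exact Subtype.ext (Prod.ext h1 h3)
  simpa using LinearMap.finrank_le_finrank_of_injective hinj

/-- For the lower bound, the shift `a` separates two frequencies, so their left-endpoint vectors
`(1, e(la))` and `(1, e(ma))` are independent. -/
theorem IsSpectralPair.finrank_spectralSpan {r a : ℝ} (hr0 : 0 < r) (hr1 : r < 1) (hra : r < a)
    {Λ : Set ℝ} (h : IsSpectralPair (twoIntervals r a) Λ) :
    Module.finrank ℂ (spectralSpan r a Λ) = 2 := by
  refine le_antisymm (finrank_span_le_two (h.isMutuallyNull hr0 hr1 hra)) ?_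
  have hex (l₀ : ℝ) := h.exists_unitExp_ne_one hr0 hr1 hra (t := a) (by linarith) (by linarith) l₀
  obtain ⟨l, hl, -⟩ := hex 0
  obtain ⟨m, hm, hne⟩ := hex l
  have hmem {l : ℝ} (hl : l ∈ Λ) : embed r a l ∈ spectralSpan r a Λ :=
    Submodule.subset_span ⟨l, hl, rfl⟩
  have hli : LinearIndependent ℂ
      ![(⟨_, hmem hl⟩ : spectralSpan r a Λ), ⟨_, hmem hm⟩] := by
    rw [LinearIndependent.pair_iff]
    intro s t hst
    have h1 := congrArg (fun v : spectralSpan r a Λ => (v : (Fin 2 → ℂ) × (Fin 2 → ℂ)).2) hst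
    have h2 := congrFun h1 0
    have h3 := congrFun h1 1
    simp [embed] at h2 h3
    have hne' : unitExp (m * a) - unitExp (l * a) ≠ 0 := by
      intro h0
      apply hne
      rw [sub_mul, unitExp_sub, sub_eq_zero.1 h0, div_self (unitExp_ne_zero _)]
    have ht : t = 0 := by
      have : t * (unitExp (m * a) - unitExp (l * a)) = 0 := by
        linear_combination h3 - unitExp (l * a) * h2
      exact (mul_eq_zero.1 this).resolve_right hne'
    exact ⟨by simpa [ht] using h2, ht⟩
  simpa using hli.fintype_card_le_finrank

end Fuglede

theorem mainTheorem1 (r a : ℝ) (hr0 : 0 < r) (hr1 : r < 1) (hra : r < a) :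
    (Fuglede.IsSpectralSet (Fuglede.twoIntervals r a) →
      Fuglede.TilesByTranslation (Fuglede.twoIntervals r a)) ∧
    ∀ Λ : Set ℝ, Fuglede.IsSpectralPair (Fuglede.twoIntervals r a) Λ →
      Fuglede.IsMutuallyNull (Fuglede.embed r a '' Λ) ∧
      Module.finrank ℂ (Fuglede.spectralSpan r a Λ) = 2 ∧
      ((0 : ℝ) ∈ Λ →
        (Λ = Fuglede.integers ∧
          Fuglede.IsTilingPair (Fuglede.twoIntervals r a) Fuglede.integers) ∨
        (r = 1 / 2 ∧ ∃ n : ℤ, a = (n : ℝ) / 2)) := by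
  refine ⟨fun ⟨Λ, h⟩ => h.tilesByTranslation hr0 hr1 hra, fun Λ h =>
    ⟨h.isMutuallyNull hr0 hr1 hra, h.finrank_spectralSpan hr0 hr1 hra, fun h0 => ?_⟩⟩
  refine (h.int_or_half hr0 hr1 hra h0).imp_left fun hZ => ?_
  obtain ⟨m, hm⟩ := h.exists_int_sub_eq hr0 hr1 hra hZ
  refine ⟨h.eq_integers hr0 hr1 hra (fun l hl => ?_) hm,
    Fuglede.isTilingPair_integers hr0 hr1 hra hm⟩
  obtain ⟨n, hn⟩ := hZ l hl
  exact ⟨n, by simpa using hn.symm⟩
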